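/- A semifield is a set $S$ with two associative, commutative binary operations $+$ and $\times$ such that $\times$ distributes over $+$, there is an element $0$ that is an identity for $+$ and a zero for $\times$, and $S\setminus\{0\}$ is a group under $\times$ (so a semifield satisfies all field axioms except possibly the existence of additive inverses). For $n\in\mathbb{N}$ let $M_n(S)$ be the set of $n\times n$ matrices over $S$, viewed both as an $S$-module and as a monoid under matrix multiplication, and let $GL_n(S)$ be the group of invertible elements of this monoid. For $A,B\in M_n(S)$ write: $A\le_{\mathcal R}B$ if $A=BX$ for some $X\in M_n(S)$; $A\le_{\mathcal L}B$ if $A=XB$ for some $X\in M_n(S)$; $A\le_{\mathcal J}B$ if $A=XBY$ for some $X,Y\in M_n(S)$; and $A\le_{\mathcal H}B$ if $A\le_{\mathcal R}B$ and $A\le_{\mathcal L}B$. Write $A\,\mathcal R\,B$, $A\,\mathcal L\,B$, $A\,\mathcal J\,B$ if the corresponding preorder relation holds in both directions, and write $A\,\mathcal H\,B$ if $A\,\mathcal R\,B$ and $A\,\mathcal L\,B$. A map $T\colon M_n(S)\to M_n(S)$ preserves a binary relation $\equiv$ on $M_n(S)$ if $A\equiv B$ implies $T(A)\equiv T(B)$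 for all $A,B\in M_n(S)$. **Theorem.** Let $S$ be a semifield, $n\in\mathbb{N}$, and let $T\colon M_n(S)\to M_n(S)$ be a bijective $S$-linear map. Then the following are equivalent: (i) $T$ preserves $\mathcal J$; (ii) $T$ preserves $\le_{\mathcal J}$; (iii) $T$ preserves $\mathcal H$; (iv) $T$ preserves $\le_{\mathcal H}$; (v) there exist $P,Q\in GL_n(S)$ such that either $T(A)=PAQ$ for all $A\in M_n(S)$, or $T(A)=PA^{T}Q$ for all $A\in M_n(S)$, where $A^T$ denotes the transpose of $A$. -/

import Mathlib

namespace Green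

variable {M : Type*} [Monoid M]

/-- The right Green preorder on a monoid: `a ≤_R b` iff `a ∈ bM`. -/
def LeR (a b : M) : Prop := ∃ s : M, a = b * s

/-- The left Green preorder on a monoid: `a ≤_L b` iff `a ∈ Mb`. -/
def LeL (a b : M) : Prop := ∃ s : M, a = s * b

/-- The two-sided Green preorder on a monoid: `a ≤_J b` iff `a ∈ MbM`. -/
def LeJ (a b : M) : Prop := ∃ s t : M, a = s * b * t

/-- `a ≤_H b` iff `a ≤_R b` and `a ≤_L b`. -/
def LeH (a b : M) : Prop := LeR a b ∧ LeL a b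

/-- Green's relation `R`. -/
def RelR (a b : M) : Prop := LeR a b ∧ LeR b a

/-- Green's relation `L`. -/
def RelL (a b : M) : Prop := LeL a b ∧ LeL b a

/-- Green's relation `J`. -/
def RelJ (a b : M) : Prop := LeJ a b ∧ LeJ b a

/-- Green's relation `H`: `a H b` iff `a R b` and `a L b`. -/
def RelH (a b : M) : Prop := RelR a b ∧ RelL a b

/-- The map `f` (weakly) preserves the binary relation `r`. -/
def Preserves {X : Type*} (f : X → X) (r : X → X → Prop) : Prop :=
  ∀ a b : X, r a b → r (f a) (f b)

end Green

/-! The substance is that preserving `RelJ` or `RelH` forces the standard form. Either `1` has an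
additive inverse and `S` is a field, or sums vanish only termwise (`Zerosumfree`). Both cases work
with outer products `u vᵀ`, the nonzero ones forming a single J-class.

The common engine is `exists_isHadamardStandard`. Suppose matrix units go to outer products, and
units in a common row or column have images with parallel left or right factors. Then, up to units
and transposition, `T` is a Hadamard product with a matrix `C` having no zero entry. If `C` is
itself an outer product, this is a diagonal scaling and `T` is standard.

Without cancellation, `T` permutes matrix units up to scalars. For J, outer products map to outer
products. For H, counting shows that collinear units stay collinear, and `Zerosumfree.eq_one` forces
the 2×2 minors of `C` to vanish.

Over a field it suffices that `T` or its inverse preserves outer products. For H the inverse does,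
because only scalar multiples lie H-below `u vᵀ`. For J one nonzero outer product with outer image
is enough; its absence would force the two-element field, which is then excluded directly. -/

set_option linter.unusedSectionVars false

namespace Green

/-! ### Green's relations in a monoid and multiplication by units. -/

section Monoid

variable {M : Type*} [Monoid M]

theorem LeJ.trans {a b c : M} (h₁ : LeJ a b) (h₂ : LeJ b c) : LeJ a c := by
  obtain ⟨s, t, rfl⟩ := h₁
  obtain ⟨s', t', rfl⟩ := h₂
  exact ⟨s * s', t' * t, by simp only [mul_assoc]⟩

theorem RelJ.symm {a b : M} (h : RelJ a b) : RelJ b a := ⟨h.2, h.1⟩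

theorem RelJ.trans {a b c : M} (h₁ : RelJ a b) (h₂ : RelJ b c) : RelJ a c :=
  ⟨h₁.1.trans h₂.1, h₂.2.trans h₁.2⟩

theorem relJ_units_mul_mul (p q : Mˣ) (a : M) : RelJ (p * a * q) a :=
  ⟨⟨p, q, rfl⟩, ⟨(p⁻¹ : Mˣ), (q⁻¹ : Mˣ), by simp [mul_assoc]⟩⟩

theorem RelJ.units_mul_mul (p q : Mˣ) {a b : M} (h : RelJ a b) :
    RelJ (p * a * q) (p * b * q) :=
  ((relJ_units_mul_mul p q a).trans h).trans (relJ_units_mul_mul p q b).symm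

theorem relH_of_units {a b : M} (p q : Mˣ) (hp : b = p * a) (hq : b = a * q) : RelH a b := by
  refine ⟨⟨⟨(q⁻¹ : Mˣ), by simp [hq]⟩, ⟨q, hq⟩⟩, ⟨⟨(p⁻¹ : Mˣ), by simp [hp]⟩, ⟨p, hp⟩⟩⟩

theorem LeR.units_mul_mul (p q : Mˣ) {a b : M} (h : LeR a b) :
    LeR (p * a * q) (p * b * q) := by
  obtain ⟨s, rfl⟩ := h
  exact ⟨(q⁻¹ : Mˣ) * s * q, by simp [mul_assoc]⟩

theorem LeL.units_mul_mul (p q : Mˣ) {a b : M} (h : LeL a b) :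
    LeL (p * a * q) (p * b * q) := by
  obtain ⟨s, rfl⟩ := h
  exact ⟨p * s * (p⁻¹ : Mˣ), by simp [mul_assoc]⟩

theorem LeH.units_mul_mul (p q : Mˣ) {a b : M} (h : LeH a b) :
    LeH (p * a * q) (p * b * q) :=
  ⟨h.1.units_mul_mul p q, h.2.units_mul_mul p q⟩

theorem relH_iff_leH {a b : M} : RelH a b ↔ LeH a b ∧ LeH b a := by
  unfold RelH LeH RelR RelL
  tauto

theorem RelH.units_mul_mul (p q : Mˣ) {a b : M} (h : RelH a b) :
    RelH (p * a * q) (p * b * q) := by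
  rw [relH_iff_leH] at h ⊢
  exact ⟨h.1.units_mul_mul p q, h.2.units_mul_mul p q⟩

theorem preserves_relJ_of_leJ {f : M → M} (h : Preserves f LeJ) : Preserves f RelJ :=
  fun _ _ hab => ⟨h _ _ hab.1, h _ _ hab.2⟩

theorem preserves_relH_of_leH {f : M → M} (h : Preserves f LeH) : Preserves f RelH := by
  intro a b hab
  rw [relH_iff_leH] at hab ⊢
  exact ⟨h _ _ hab.1, h _ _ hab.2⟩

end Monoid

/-! ### Standard maps, outer products and parallel vectors. -/

section Matrix

open Matrix

variable {S ι : Type*} [Semifield S] [Fintype ι] [DecidableEq ι]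

theorem LeJ.transpose {A B : Matrix ι ι S} (h : LeJ A B) : LeJ Aᵀ Bᵀ := by
  obtain ⟨X, Y, rfl⟩ := h
  exact ⟨Yᵀ, Xᵀ, by simp [Matrix.mul_assoc]⟩

theorem LeH.transpose {A B : Matrix ι ι S} (h : LeH A B) : LeH Aᵀ Bᵀ := by
  obtain ⟨⟨X, hX⟩, ⟨Y, hY⟩⟩ := h
  exact ⟨⟨Yᵀ, by rw [hY, Matrix.transpose_mul]⟩, ⟨Xᵀ, by rw [hX, Matrix.transpose_mul]⟩⟩

theorem RelH.transpose {A B : Matrix ι ι S} (h : RelH A B) : RelH Aᵀ Bᵀ := by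
  rw [relH_iff_leH] at h ⊢
  exact ⟨h.1.transpose, h.2.transpose⟩

/-- `T` is `A ↦ P A Q` or `A ↦ P Aᵀ Q` with `P` and `Q` invertible. -/
def IsStandard (T : Matrix ι ι S → Matrix ι ι S) : Prop :=
  ∃ P Q : (Matrix ι ι S)ˣ, (∀ A, T A = P.val * A * Q.val) ∨ (∀ A, T A = P.val * Aᵀ * Q.val)

theorem IsStandard.preserves_leJ {T : Matrix ι ι S → Matrix ι ι S} (h : IsStandard T) :
    Preserves T LeJ := by
  obtain ⟨P, Q, h | h⟩ := h
  · intro A B hAB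
    rw [h, h]
    exact ((relJ_units_mul_mul P Q A).1.trans hAB).trans (relJ_units_mul_mul P Q B).2
  · intro A B hAB
    rw [h, h]
    exact ((relJ_units_mul_mul P Q Aᵀ).1.trans hAB.transpose).trans (relJ_units_mul_mul P Q Bᵀ).2

theorem IsStandard.preserves_leH {T : Matrix ι ι S → Matrix ι ι S} (h : IsStandard T) :
    Preserves T LeH := by
  obtain ⟨P, Q, h | h⟩ := h
  · intro A B hAB
    rw [h, h]
    exact hAB.units_mul_mul P Q
  · intro A B hAB
    rw [h, h]
    exact hAB.transpose.units_mul_mul P Q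

/-- The matrices of the form `u vᵀ`. -/
def IsOuter (A : Matrix ι ι S) : Prop := ∃ u v : ι → S, A = vecMulVec u v

theorem isOuter_vecMulVec (u v : ι → S) : IsOuter (vecMulVec u v) := ⟨u, v, rfl⟩

theorem IsOuter.minor {A : Matrix ι ι S} (h : IsOuter A) (i j k l : ι) :
    A i j * A k l = A i l * A k j := by
  obtain ⟨u, v, rfl⟩ := h
  simp only [vecMulVec_apply]
  ring

theorem isOuter_of_minor {A : Matrix ι ι S}
    (h : ∀ i j k l, A i j * A k l = A i l * A k j) : IsOuter A := by
  by_cases hA : ∃ i j, A i j ≠ 0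
  · obtain ⟨i, j, hij⟩ := hA
    refine ⟨fun k => A k j / A i j, fun l => A i l, ?_⟩
    ext k l
    rw [vecMulVec_apply, div_mul_eq_mul_div, eq_div_iff hij, h k l i j]
  · push Not at hA
    exact ⟨0, 0, by ext i j; simp [hA]⟩

theorem LeJ.isOuter {A B : Matrix ι ι S} (h : LeJ A B) (hB : IsOuter B) : IsOuter A := by
  obtain ⟨X, Y, rfl⟩ := h
  obtain ⟨u, v, rfl⟩ := hB
  rw [mul_vecMulVec, vecMulVec_mul]
  exact isOuter_vecMulVec _ _

theorem exists_ne_zero_of_vecMulVec_ne_zero {u v : ι → S} (h : vecMulVec u v ≠ 0) :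
    u ≠ 0 ∧ v ≠ 0 := by
  constructor <;> rintro rfl <;> simp at h

theorem leJ_of_isOuter {A B : Matrix ι ι S} (hA : IsOuter A) (hB : IsOuter B) (h0 : B ≠ 0) :
    LeJ A B := by
  obtain ⟨u, v, rfl⟩ := hA
  obtain ⟨u', v', rfl⟩ := hB
  obtain ⟨hu, hv⟩ := exists_ne_zero_of_vecMulVec_ne_zero h0
  obtain ⟨i, hi⟩ := Function.ne_iff.1 hu
  obtain ⟨j, hj⟩ := Function.ne_iff.1 hv
  -- The inner factors pair with `u'` and `v'` to give 1, leaving `u vᵀ`.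
  refine ⟨vecMulVec u (Pi.single i (u' i)⁻¹), vecMulVec (Pi.single j (v' j)⁻¹) v, ?_⟩
  rw [mul_vecMulVec, vecMulVec_mul, vecMulVec_mulVec, vecMul_vecMulVec]
  simp_all

theorem relJ_of_isOuter {A B : Matrix ι ι S} (hA : IsOuter A) (hB : IsOuter B) (hA0 : A ≠ 0)
    (hB0 : B ≠ 0) : RelJ A B :=
  ⟨leJ_of_isOuter hA hB hB0, leJ_of_isOuter hB hA hA0⟩

/-- The two factorizations give `u (vX)ᵀ = (Yu) vᵀ`; a row where `u` is nonzero shows that `vX` is a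
multiple of `v`. -/
theorem eq_smul_of_leH_vecMulVec {A : Matrix ι ι S} {u v : ι → S} (h : LeH A (vecMulVec u v)) :
    ∃ c : S, A = c • vecMulVec u v := by
  obtain ⟨⟨X, hX⟩, ⟨Y, hY⟩⟩ := h
  rw [vecMulVec_mul] at hX
  rw [mul_vecMulVec] at hY
  by_cases hu : u = 0
  · exact ⟨0, by simp [hX, hu]⟩
  obtain ⟨i, hi⟩ := Function.ne_iff.1 hu
  refine ⟨(Y *ᵥ u) i / u i, ?_⟩
  have hi' : u i ≠ 0 := hi
  have key (l) : u i * (v ᵥ* X) l = (Y *ᵥ u) i * v l := by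
    simpa [vecMulVec_apply] using congrFun (congrFun (hX.symm.trans hY) i) l
  ext k l
  rw [hX, Matrix.smul_apply, vecMulVec_apply, vecMulVec_apply, smul_eq_mul,
    div_mul_eq_mul_div, eq_div_iff hi']
  calc u k * (v ᵥ* X) l * u i = u k * (u i * (v ᵥ* X) l) := by ring
    _ = (Y *ᵥ u) i * (u k * v l) := by rw [key]; ring

/-- The vectors `u` and `v` differ by a nonzero scalar. -/
def Parallel (u v : ι → S) : Prop := ∃ c : S, c ≠ 0 ∧ u = c • v

variable (S ι) in
/-- Vectors up to nonzero scalars. -/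
def parallelSetoid : Setoid (ι → S) where
  r := Parallel
  iseqv :=
    { refl := fun u => ⟨1, one_ne_zero, by simp⟩
      symm := by
        rintro u v ⟨c, hc, rfl⟩
        exact ⟨c⁻¹, inv_ne_zero hc, by simp [smul_smul, hc]⟩
      trans := by
        rintro u v w ⟨c, hc, rfl⟩ ⟨d, hd, rfl⟩
        exact ⟨c * d, mul_ne_zero hc hd, by simp [smul_smul]⟩ }

theorem parallel_of_minor {u v : ι → S} (hu : u ≠ 0) (hv : v ≠ 0)
    (h : ∀ i k, u i * v k = u k * v i) : Parallel u v := by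
  obtain ⟨k, hk⟩ := Function.ne_iff.1 hv
  have hk' : v k ≠ 0 := hk
  have hne : u k ≠ 0 := by
    intro h0
    refine hu (funext fun i => ?_)
    simpa [h0, hk'] using h i k
  refine ⟨u k / v k, div_ne_zero hne hk', ?_⟩
  ext i
  rw [Pi.smul_apply, smul_eq_mul, div_mul_eq_mul_div, eq_div_iff hk', h]

end Matrix

end Green

namespace Green

/-! ### Combinatorics of labelled grids. -/

section Combinatorics

theorem forall_eq_or_forall_eq {ι X Y : Type*} {f : ι → X} {g : ι → Y}
    (h : ∀ j l, f j = f l ∨ g j = g l) : (∀ j l, f j = f l) ∨ (∀ j l, g j = g l) := by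
  by_contra! hc
  obtain ⟨⟨j, l, hjl⟩, ⟨p, q, hpq⟩⟩ := hc
  have h1 := h j l
  have h2 := h p q
  have h3 := h j p
  have h4 := h j q
  have h5 := h l p
  have h6 := h l q
  grind

theorem rows_eq_or_rows_eq {ι X Y : Type*} [Nontrivial ι] {a : ι → ι → X} {b : ι → ι → Y}
    (hinj : ∀ i j k l, a i j = a k l → b i j = b k l → i = k ∧ j = l)
    (hrow : ∀ i j l, a i j = a i l ∨ b i j = b i l)
    (hcol : ∀ i k j, a i j = a k j ∨ b i j = b k j) :
    (∀ i j l, a i j = a i l) ∨ (∀ i j l, b i j = b i l) := by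
  have hr := fun i => forall_eq_or_forall_eq (hrow i)
  -- Otherwise `b` is a constant β on some row `i` and `a` a constant α on some row `k`. By `hcol`,
  -- each column then has the label (α, β) in row `i` or row `k`, so two columns contradict
  -- injectivity.
  by_contra! hc
  obtain ⟨⟨i, p, q, hi⟩, ⟨k, p', q', hk⟩⟩ := hc
  have hbi : ∀ j l, b i j = b i l := (hr i).resolve_left fun h => hi (h p q)
  have hak : ∀ j l, a k j = a k l := (hr k).resolve_right fun h => hk (h p' q')
  obtain ⟨j, l, hjl⟩ := exists_pair_ne ι
  have h1 := hinj i j i l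
  have h2 := hinj k j k l
  have h3 := hinj i j k l
  have h4 := hinj i l k j
  have h5 := hinj i j k j
  have h6 := hinj i l k l
  have := hcol i k j
  have := hcol i k l
  have := hbi j l
  have := hak j l
  grind

end Combinatorics

/-! ### Linear maps sending matrix units to outer products. -/

open Matrix

variable {S ι : Type*} [Semifield S] [Fintype ι] [DecidableEq ι]

theorem map_apply_eq_sum (T : Matrix ι ι S →ₗ[S] Matrix ι ι S) (A : Matrix ι ι S) (k l : ι) :
    T A k l = ∑ i, ∑ j, A i j * T (single i j 1) k l := by
  conv_lhs => rw [matrix_eq_sum_single A]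
  simp only [map_sum, Matrix.sum_apply]
  refine Finset.sum_congr rfl fun i _ => Finset.sum_congr rfl fun j _ => ?_
  rw [show single i j (A i j) = A i j • single i j (1 : S) by simp [smul_single], map_smul,
    Matrix.smul_apply, smul_eq_mul]

theorem isUnit_of_mul_mul_eq_one {P X Q : Matrix ι ι S} (h : P * X * Q = 1) :
    IsUnit P ∧ IsUnit Q := by
  constructor
  · have h' : P * (X * Q) = 1 := by rw [← h, Matrix.mul_assoc]
    exact ⟨⟨P, X * Q, h', mul_eq_one_comm.1 h'⟩, rfl⟩
  · exact ⟨⟨Q, P * X, mul_eq_one_comm.1 h, h⟩, rfl⟩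

/-- A linear bijection whose values on matrix units are `c i j • a i (b j)ᵀ`. -/
theorem exists_hadamard_of_map_single {T : Matrix ι ι S →ₗ[S] Matrix ι ι S}
    (hT : Function.Bijective T) (a b : ι → ι → S) (C : Matrix ι ι S)
    (h : ∀ i j, T (single i j 1) = C i j • vecMulVec (a i) (b j)) :
    (∀ i j, C i j ≠ 0) ∧ ∃ P Q : (Matrix ι ι S)ˣ, ∀ A, T A = P.val * (C ⊙ A) * Q.val := by
  refine ⟨fun i j h0 => ?_, ?_⟩
  · have h1 : T (single i j 1) = T 0 := by rw [h, h0, zero_smul, map_zero]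
    have h2 := congrFun (congrFun (hT.1 h1) i) j
    simp at h2
  · have key (A) : T A = (of a)ᵀ * (C ⊙ A) * of b := by
      ext k l
      rw [map_apply_eq_sum, Finset.sum_comm]
      simp only [h, Matrix.mul_apply, Finset.sum_mul, Matrix.smul_apply, vecMulVec_apply,
        smul_eq_mul, transpose_apply, of_apply, hadamard_apply]
      refine Finset.sum_congr rfl fun i _ => Finset.sum_congr rfl fun j _ => ?_
      ring
    -- Since the identity is a value, both outer factors have one-sided inverses, which are
    -- two-sided for square matrices.
    obtain ⟨A, hA⟩ := hT.2 1
    rw [key] at hA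
    obtain ⟨⟨P, hP⟩, ⟨Q, hQ⟩⟩ := isUnit_of_mul_mul_eq_one hA
    exact ⟨P, Q, by rw [hP, hQ]; exact key⟩

/-- Every value has the form `u wᵀ`, and the identity of size at least 2 does not. -/
theorem not_surjective_of_left_parallel [Nontrivial ι] {T : Matrix ι ι S →ₗ[S] Matrix ι ι S}
    (u : ι → S) (v : ι → ι → ι → S)
    (h : ∀ i j, ∃ c : S, T (single i j 1) = vecMulVec (c • u) (v i j)) :
    ¬ Function.Surjective T := by
  intro hT
  choose c h using h
  obtain ⟨A, hA⟩ := hT 1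
  have key (k l) : T A k l = u k * ∑ i, ∑ j, A i j * c i j * v i j l := by
    rw [map_apply_eq_sum]
    simp only [h, vecMulVec_apply, Finset.mul_sum, Pi.smul_apply, smul_eq_mul]
    refine Finset.sum_congr rfl fun i _ => Finset.sum_congr rfl fun j _ => ?_
    ring
  obtain ⟨i, j, hij⟩ := exists_pair_ne ι
  have h1 := key i i
  have h2 := key j j
  have h3 := key i j
  rw [hA] at h1 h2 h3
  rw [one_apply_eq] at h1 h2
  rw [one_apply_ne hij] at h3
  rcases mul_eq_zero.1 h3.symm with h3 | h3
  · simp [h3] at h1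
  · simp [h3] at h2

/-- Precomposition with the transpose. -/
def precompTranspose (T : Matrix ι ι S →ₗ[S] Matrix ι ι S) : Matrix ι ι S →ₗ[S] Matrix ι ι S :=
  T ∘ₗ (transposeLinearEquiv ι ι S S).toLinearMap

theorem precompTranspose_apply (T : Matrix ι ι S →ₗ[S] Matrix ι ι S) (A : Matrix ι ι S) :
    precompTranspose T A = T Aᵀ := rfl

theorem precompTranspose_bijective {T : Matrix ι ι S →ₗ[S] Matrix ι ι S}
    (hT : Function.Bijective T) : Function.Bijective (precompTranspose T) :=
  hT.comp (transposeLinearEquiv ι ι S S).bijective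

/-- Postcomposition with the transpose. -/
def postcompTranspose (T : Matrix ι ι S →ₗ[S] Matrix ι ι S) : Matrix ι ι S →ₗ[S] Matrix ι ι S :=
  (transposeLinearEquiv ι ι S S).toLinearMap ∘ₗ T

theorem postcompTranspose_apply (T : Matrix ι ι S →ₗ[S] Matrix ι ι S) (A : Matrix ι ι S) :
    postcompTranspose T A = (T A)ᵀ := rfl

theorem not_surjective_of_right_parallel [Nontrivial ι] {T : Matrix ι ι S →ₗ[S] Matrix ι ι S}
    (u : ι → ι → ι → S) (v : ι → S)
    (h : ∀ i j, ∃ c : S, T (single i j 1) = vecMulVec (u i j) (c • v)) :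
    ¬ Function.Surjective T := by
  intro hT
  refine not_surjective_of_left_parallel (T := postcompTranspose T) v u (fun i j => ?_)
    ((transposeLinearEquiv ι ι S S).surjective.comp hT)
  obtain ⟨c, hc⟩ := h i j
  exact ⟨c, by rw [postcompTranspose_apply, hc, transpose_vecMulVec]⟩

/-- `T` is, up to invertible factors, `A ↦ C ⊙ A` or `A ↦ C ⊙ Aᵀ`. -/
def IsHadamardStandard (T : Matrix ι ι S → Matrix ι ι S) (C : Matrix ι ι S) : Prop :=
  (∀ i j, C i j ≠ 0) ∧ ∃ P Q : (Matrix ι ι S)ˣ,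
    (∀ A, T A = P.val * (C ⊙ A) * Q.val) ∨ (∀ A, T A = P.val * (C ⊙ Aᵀ) * Q.val)

theorem exists_isHadamardStandard_aux {T : Matrix ι ι S →ₗ[S] Matrix ι ι S}
    (hT : Function.Bijective T) (i₀ : ι) {u v : ι → ι → ι → S}
    (huv : ∀ i j, T (single i j 1) = vecMulVec (u i j) (v i j))
    (hu : ∀ i j l, Parallel (u i j) (u i l)) (hv : ∀ i k j, Parallel (v i j) (v k j)) :
    ∃ C : Matrix ι ι S,
      (∀ i j, C i j ≠ 0) ∧ ∃ P Q : (Matrix ι ι S)ˣ, ∀ A, T A = P.val * (C ⊙ A) * Q.val := by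
  choose c _ hc using fun i j => hu i j i₀
  choose d _ hd using fun i j => hv i i₀ j
  refine ⟨of fun i j => c i j * d i j,
    exists_hadamard_of_map_single hT (fun i => u i i₀) (fun j => v i₀ j) _ fun i j => ?_⟩
  rw [huv, hc i j, hd i j, smul_vecMulVec, vecMulVec_smul, smul_smul, of_apply]

theorem exists_isHadamardStandard [Nontrivial ι] {T : Matrix ι ι S →ₗ[S] Matrix ι ι S}
    (hT : Function.Bijective T) {u v : ι → ι → ι → S}
    (huv : ∀ i j, T (single i j 1) = vecMulVec (u i j) (v i j))
    (hrow : ∀ i j l, Parallel (u i j) (u i l) ∨ Parallel (v i j) (v i l))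
    (hcol : ∀ i k j, Parallel (u i j) (u k j) ∨ Parallel (v i j) (v k j)) :
    ∃ C, IsHadamardStandard T C := by
  have hinj (i j k l) (h1 : Parallel (u i j) (u k l)) (h2 : Parallel (v i j) (v k l)) :
      i = k ∧ j = l := by
    obtain ⟨c, hc, h1⟩ := h1
    obtain ⟨d, hd, h2⟩ := h2
    have h3 : T (single i j 1) = T ((c * d) • single k l 1) := by
      rw [map_smul, huv, huv, h1, h2, smul_vecMulVec, vecMulVec_smul, smul_smul]
    have h4 := congrFun (congrFun (hT.1 h3) i) j
    by_contra hne
    rw [Matrix.smul_apply, single_apply_same, single_apply_of_ne] at h4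
    · simp at h4
    · tauto
  let q : (ι → S) → Quotient (parallelSetoid S ι) := fun w => ⟦w⟧
  have hq (w z : ι → S) : q w = q z ↔ Parallel w z := Quotient.eq
  have hR := rows_eq_or_rows_eq (a := fun i j => q (u i j)) (b := fun i j => q (v i j))
    (by simpa only [hq] using hinj) (by simpa only [hq] using hrow) (by simpa only [hq] using hcol)
  have hC := rows_eq_or_rows_eq (a := fun i j => q (u j i)) (b := fun i j => q (v j i))
    (by simp only [hq]; exact fun i j k l h1 h2 => (hinj j i l k h1 h2).symm)
    (by simp only [hq]; exact fun i j l => hcol j l i)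
    (by simp only [hq]; exact fun i k j => hrow j i k)
  simp only [hq] at hR hC
  obtain ⟨i₀⟩ := (inferInstance : Nonempty ι)
  have trans {w z y : ι → S} (h1 : Parallel w z) (h2 : Parallel z y) : Parallel w y :=
    (parallelSetoid S ι).trans h1 h2
  -- If the same factor is constant up to scalars along both rows and columns, surjectivity fails;
  -- the two mixed cases are the direct and the transposed form.
  rcases hR with hR | hR <;> rcases hC with hC | hC
  · refine absurd hT.2 (not_surjective_of_left_parallel (u i₀ i₀) v fun i j => ?_)
    obtain ⟨c, _, hc⟩ := trans (hR i j i₀) (hC i₀ i i₀)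
    exact ⟨c, by rw [huv, hc]⟩
  · obtain ⟨C, h0, P, Q, h⟩ := exists_isHadamardStandard_aux hT i₀ huv hR fun i k j => hC j i k
    exact ⟨C, h0, P, Q, Or.inl h⟩
  · obtain ⟨C, h0, P, Q, h⟩ := exists_isHadamardStandard_aux (precompTranspose_bijective hT) i₀
      (u := fun i j => u j i) (v := fun i j => v j i)
      (fun i j => by rw [precompTranspose_apply, transpose_single, huv])
      hC fun i k j => hR j i k
    refine ⟨C, h0, P, Q, Or.inr fun A => ?_⟩
    rw [← h, precompTranspose_apply, transpose_transpose]
  · refine absurd hT.2 (not_surjective_of_right_parallel u (v i₀ i₀) fun i j => ?_)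
    obtain ⟨c, _, hc⟩ := trans (hR i j i₀) (hC i₀ i i₀)
    exact ⟨c, by rw [huv, hc]⟩

theorem IsHadamardStandard.isStandard {T : Matrix ι ι S → Matrix ι ι S} {C : Matrix ι ι S}
    (h : IsHadamardStandard T C) (hC : IsOuter C) : IsStandard T := by
  obtain ⟨h0, P, Q, h⟩ := h
  cases isEmpty_or_nonempty ι
  · exact ⟨1, 1, Or.inl fun A => Subsingleton.elim _ _⟩
  obtain ⟨u, v, rfl⟩ := hC
  obtain ⟨i₀⟩ := ‹Nonempty ι›
  have hu (i) : u i ≠ 0 := left_ne_zero_of_mul (h0 i i₀)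
  have hv (j) : v j ≠ 0 := right_ne_zero_of_mul (h0 i₀ j)
  have hunit (w : ι → S) (hw : ∀ i, w i ≠ 0) : ∃ W : (Matrix ι ι S)ˣ, W.val = diagonal w :=
    ⟨⟨diagonal w, diagonal fun i => (w i)⁻¹, by simp [diagonal_mul_diagonal, hw],
      by simp [diagonal_mul_diagonal, hw]⟩, rfl⟩
  obtain ⟨U, hU⟩ := hunit u hu
  obtain ⟨V, hV⟩ := hunit v hv
  have key (A : Matrix ι ι S) : vecMulVec u v ⊙ A = U.val * A * V.val := by
    ext i j
    rw [hU, hV, mul_diagonal, diagonal_mul, hadamard_apply, vecMulVec_apply]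
    ring
  refine ⟨P * U, V * Q, ?_⟩
  simpa only [key, Units.val_mul, Matrix.mul_assoc] using h

end Green

namespace Green

open Matrix

variable {S ι : Type*} [Semifield S] [Fintype ι] [DecidableEq ι]

/-- The all-ones matrix is symmetric and neutral for `⊙`, so its image is `C` up to invertible
factors. -/
theorem IsHadamardStandard.isOuter {T : Matrix ι ι S → Matrix ι ι S} {C : Matrix ι ι S}
    (h : IsHadamardStandard T C) (h1 : IsOuter (T (vecMulVec 1 1))) : IsOuter C := by
  obtain ⟨-, P, Q, h⟩ := h
  have e1 : C ⊙ vecMulVec 1 1 = C := by ext i j; simp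
  have e2 : C ⊙ (vecMulVec 1 1)ᵀ = C := by ext i j; simp
  rcases h with h | h <;> rw [h] at h1
  · rw [e1] at h1
    exact (relJ_units_mul_mul P Q C).2.isOuter h1
  · rw [e2] at h1
    exact (relJ_units_mul_mul P Q C).2.isOuter h1

/-! ### Arithmetic and matrix units without additive inverses. -/

section Zerosumfree

/-- A sum vanishes only if its summands do. -/
def Zerosumfree (S : Type*) [Semifield S] : Prop := ∀ a b : S, a + b = 0 → a = 0

theorem zerosumfree_of_one_add_ne_zero (h : ∀ a : S, 1 + a ≠ 0) : Zerosumfree S := by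
  intro a b hab
  by_contra ha
  refine h (b / a) ?_
  rw [← div_self ha, ← add_div, hab, zero_div]

variable (hS : Zerosumfree S)
include hS

theorem Zerosumfree.two_ne_zero : (2 : S) ≠ 0 := fun h =>
  one_ne_zero (hS 1 1 (by rw [one_add_one_eq_two, h]))

/-- Antisymmetry at 1 of the order "is a summand of". With `q = (a + b)⁻¹` the hypothesis reads `q +
1 = q`, whence `q + a * q = q`. -/
theorem Zerosumfree.eq_one_of_le_of_le {a b : S} (h : 1 + a + b = 1) : 1 + a = 1 := by
  by_cases hp : a + b = 0
  · rw [hS a b hp, add_zero]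
  · have h' : (a + b)⁻¹ + 1 = (a + b)⁻¹ := by
      have := congrArg (· * (a + b)⁻¹) h
      simpa [add_assoc, add_mul, hp] using this
    have hsum : a * (a + b)⁻¹ + b * (a + b)⁻¹ = 1 := by rw [← add_mul, mul_inv_cancel₀ hp]
    have key : (a + b)⁻¹ + a * (a + b)⁻¹ = (a + b)⁻¹ := by
      calc (a + b)⁻¹ + a * (a + b)⁻¹
          = (a + b)⁻¹ * (a * (a + b)⁻¹ + b * (a + b)⁻¹) + a * (a + b)⁻¹ := by rw [hsum, mul_one]
        _ = a * (a + b)⁻¹ * ((a + b)⁻¹ + 1) + b * (a + b)⁻¹ * (a + b)⁻¹ := by ring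
        _ = (a + b)⁻¹ * (a * (a + b)⁻¹ + b * (a + b)⁻¹) := by rw [h']; ring
        _ = (a + b)⁻¹ := by rw [hsum, mul_one]
    have := congrArg (· * (a + b)) key
    simpa [add_mul, hp, mul_assoc] using this

/-- Halving gives `a/2 + c = b/2 + c`, and this is applied once to each half of `a`. -/
theorem Zerosumfree.add_right_halve {a b c : S} (h : a + (c + c) = b + (c + c)) :
    a + c = b + c := by
  have h2 := hS.two_ne_zero
  have e (x : S) : x = x / 2 + x / 2 := by rw [← add_div, ← two_mul, mul_div_cancel_left₀ _ h2]
  have h' : a / 2 + c = b / 2 + c := by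
    have := congrArg (· / 2) h
    simp only [add_div] at this
    rwa [← e c] at this
  calc a + c = a / 2 + (a / 2 + c) := by rw [← add_assoc, ← e]
    _ = a / 2 + (b / 2 + c) := by rw [h']
    _ = b / 2 + (a / 2 + c) := by ring
    _ = b / 2 + (b / 2 + c) := by rw [h']
    _ = b + c := by rw [← add_assoc, ← e]

/-- A summand that is at most twice either of the other summands can be cancelled. -/
theorem Zerosumfree.add_right_cancel_of_le {a b d a' b' : S} (ha : a = d + a') (hb : b = d + b')
    (h : a + (d + d) = b + (d + d)) : a = b := by
  have h1 := hS.add_right_halve h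
  have h2 : a' + (d + d) = b' + (d + d) := by
    calc a' + (d + d) = a + d := by rw [ha]; ring
      _ = b + d := h1
      _ = b' + (d + d) := by rw [hb]; ring
  have h3 := hS.add_right_halve h2
  rw [ha, hb, add_comm d, add_comm d, h3]

theorem Zerosumfree.one_le_two_mul {m : S} (hm : m ≠ 0)
    (h : ∀ b : S, b ≠ 0 → ∃ x z, x + z = 1 ∧ b ^ 2 * x + m * z = 1) : ∃ r, m + m = 1 + r := by
  have h1 : 1 + m ≠ 0 := fun h0 => one_ne_zero (hS _ _ h0)
  -- This `b` satisfies `b + b * m = m` and is a summand of 1, so `b ^ 2` is a summand of `m`.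
  obtain ⟨x, z, hxz, hb⟩ := h (m / (1 + m)) (div_ne_zero hm h1)
  set b := m / (1 + m) with hbdef
  have hbm : b + b * m = m := by rw [hbdef]; field_simp
  have hb1 : b + 1 / (1 + m) = 1 := by rw [hbdef]; field_simp; ring
  have hbb : m = b ^ 2 + b * (1 / (1 + m)) + b * m := by
    calc m = b * 1 + b * m := by rw [mul_one, hbm]
      _ = b * (b + 1 / (1 + m)) + b * m := by rw [hb1]
      _ = _ := by ring
  refine ⟨m * x + (b ^ 2 * z + b * (1 / (1 + m)) + b * m), ?_⟩
  calc m + m = m * (x + z) + (b ^ 2 * (x + z) + b * (1 / (1 + m)) + b * m) := by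
        rw [hxz, mul_one, mul_one, ← hbb]
    _ = (b ^ 2 * x + m * z) + (m * x + (b ^ 2 * z + b * (1 / (1 + m)) + b * m)) := by ring
    _ = _ := by rw [hb]

theorem Zerosumfree.le_one {m : S} (h : ∀ b : S, b ≠ 0 → ∃ x z, x + z = 1 ∧ b ^ 2 * x + m * z = 1)
    (hm : ∃ r, 2 = m + r) : ∃ g, m + g = 1 := by
  obtain ⟨r, hr⟩ := hm
  -- With `2 = m + r`, the choice `b = 2` gives `m + g + m * x = 1 + m * x` for `g = r * x + 2 * x`.
  -- Here `m * x / 2` is a summand of both `m + g` and 1, so `m * x` cancels.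
  obtain ⟨x, z, hxz, hb⟩ := h 2 hS.two_ne_zero
  have h2 := hS.two_ne_zero
  refine ⟨r * x + 2 * x, ?_⟩
  have e (y : S) : y = y / 2 + y / 2 := by rw [← add_div, ← two_mul, mul_div_cancel_left₀ _ h2]
  have hm1 : 1 = m / 2 + r / 2 := by rw [← add_div, ← hr, div_self h2]
  refine hS.add_right_cancel_of_le (d := m * x / 2)
    (a' := m * x / 2 + m * z + (r * x + 2 * x)) (b' := m * z / 2 + r / 2) ?_ ?_ ?_
  · calc m + (r * x + 2 * x) = m * (x + z) + (r * x + 2 * x) := by rw [hxz, mul_one]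
      _ = m * x + m * z + (r * x + 2 * x) := by ring
      _ = (m * x / 2 + m * x / 2) + m * z + (r * x + 2 * x) := by rw [← e]
      _ = _ := by ring
  · calc 1 = m * (x + z) / 2 + r / 2 := by rw [hxz, mul_one, ← hm1]
      _ = _ := by rw [mul_add, add_div, add_assoc]
  · rw [← e]
    calc m + (r * x + 2 * x) + m * x = m * (x + z) + ((m + r) * x + 2 * x) := by
          rw [hxz]; ring
      _ = (2 ^ 2 * x + m * z) + m * x := by rw [← hr]; ring
      _ = 1 + m * x := by rw [hb]

/-- Both `m` and `m⁻¹` are summands of 1, so antisymmetry applies. -/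
theorem Zerosumfree.eq_one {m : S} (hm : m ≠ 0)
    (h : ∀ b : S, b ≠ 0 → ∃ x z, x + z = 1 ∧ b ^ 2 * x + m * z = 1)
    (h' : ∀ b : S, b ≠ 0 → ∃ x z, x + z = 1 ∧ b ^ 2 * x + m⁻¹ * z = 1) : m = 1 := by
  have aux {k : S} (hk : k ≠ 0) (hr : ∃ r, k⁻¹ + k⁻¹ = 1 + r) : ∃ r, 2 = k + r := by
    obtain ⟨r, hr⟩ := hr
    refine ⟨k * r, ?_⟩
    rw [← mul_one_add, ← hr, mul_add, mul_inv_cancel₀ hk, one_add_one_eq_two]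
  obtain ⟨g, hg⟩ := hS.le_one h (aux hm (hS.one_le_two_mul (inv_ne_zero hm) h'))
  obtain ⟨g', hg'⟩ := hS.le_one h'
    (aux (inv_ne_zero hm) (by rw [inv_inv]; exact hS.one_le_two_mul hm h))
  have h1 : 1 + m * g' = m := by
    calc 1 + m * g' = m * (m⁻¹ + g') := by rw [mul_add, mul_inv_cancel₀ hm]
      _ = m := by rw [hg', mul_one]
  have h2 := hS.eq_one_of_le_of_le (a := m * g') (b := g) (by rw [h1, hg])
  rw [← h1, h2]

/-- Linear bijections act on matrix units by a permutation and nonzero scalars. -/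
theorem Zerosumfree.exists_map_single {T : Matrix ι ι S →ₗ[S] Matrix ι ι S}
    (hT : Function.Bijective T) (i j : ι) :
    ∃ p : ι × ι, ∃ c : S, c ≠ 0 ∧ T (single i j 1) = c • single p.1 p.2 1 := by
  let e := LinearEquiv.ofBijective T hT
  set M := T (single i j 1) with hM
  have hM0 : M ≠ 0 := by
    intro h0
    have := congrFun (congrFun (hT.1 (h0.trans (map_zero T).symm)) i) j
    simp at this
  obtain ⟨k, hk⟩ := Function.ne_iff.1 hM0
  obtain ⟨l, hl⟩ := Function.ne_iff.1 hk
  have hl' : M k l ≠ 0 := hl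
  have hsymm : e.symm M = single i j 1 := e.symm_apply_apply _
  -- Expanding `M` writes the unit at `(i, j)` as a sum of multiples of preimages of units. Off `(i,
  -- j)` each term must vanish, in particular the one with coefficient `M k l ≠ 0`.
  have hzero (p q : ι) (hpq : ¬ (i = p ∧ j = q)) : e.symm (single k l 1) p q = 0 := by
    have h1 := map_apply_eq_sum e.symm.toLinearMap M p q
    rw [LinearEquiv.coe_coe, hsymm, single_apply, if_neg hpq] at h1
    have sumz {κ : Type _} (s : Finset κ) (f : κ → S) (h : ∑ x ∈ s, f x = 0) :
        ∀ x ∈ s, f x = 0 := by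
      classical
      intro x hx
      rw [← Finset.add_sum_erase s f hx] at h
      exact hS _ _ h
    have h2 := sumz _ _ (sumz _ _ h1.symm k (Finset.mem_univ k)) l (Finset.mem_univ l)
    exact (mul_eq_zero.1 h2).resolve_left hl'
  have hd : e.symm (single k l 1) = e.symm (single k l 1) i j • single i j 1 := by
    ext p q
    by_cases hpq : i = p ∧ j = q
    · obtain ⟨rfl, rfl⟩ := hpq
      simp
    · rw [hzero p q hpq, Matrix.smul_apply, single_apply, if_neg hpq, smul_zero]
  set d := e.symm (single k l 1) i j
  have hk : single k l 1 = d • M := by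
    have := congrArg e hd
    rwa [e.apply_symm_apply, map_smul] at this
  have hd0 : d ≠ 0 := by
    intro h0
    have := congrFun (congrFun hk k) l
    simp [h0] at this
  exact ⟨(k, l), d⁻¹, inv_ne_zero hd0, by rw [hk, smul_smul, inv_mul_cancel₀ hd0, one_smul]⟩

end Zerosumfree

end Green

/-! ### Preservers of J and H without additive inverses. -/

namespace Green

open Matrix

variable {S ι : Type*} [Semifield S] [Fintype ι] [DecidableEq ι]

theorem single_ne_zero_of_ne_zero (i j : ι) {c : S} (hc : c ≠ 0) : single i j c ≠ 0 := by
  intro h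
  have := congrFun (congrFun h i) j
  simp [hc] at this

theorem single_eq_vecMulVec (i j : ι) (c : S) :
    single i j c = vecMulVec (Pi.single i c) (Pi.single j 1) := by
  ext k l
  by_cases hk : k = i <;> by_cases hl : l = j <;>
    simp [vecMulVec_apply, hk, hl, Ne.symm]

theorem isOuter_single (i j : ι) (c : S) : IsOuter (single i j c) :=
  ⟨_, _, single_eq_vecMulVec i j c⟩

theorem isOuter_zero : IsOuter (0 : Matrix ι ι S) := ⟨0, 0, by simp⟩

theorem isOuter_map_of_preserves_relJ {T : Matrix ι ι S →ₗ[S] Matrix ι ι S}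
    (h : Preserves T RelJ) {A : Matrix ι ι S} (hA : IsOuter A) (hA0 : A ≠ 0)
    (hTA : IsOuter (T A)) {B : Matrix ι ι S} (hB : IsOuter B) : IsOuter (T B) := by
  by_cases hB0 : B = 0
  · rw [hB0, map_zero]
    exact isOuter_zero
  · exact (h _ _ (relJ_of_isOuter hB hA hB0 hA0)).1.isOuter hTA

/-- The transposition matrix exchanging two basis vectors. -/
def swapUnit (S : Type*) [Semifield S] (i k : ι) : (Matrix ι ι S)ˣ where
  val := (Equiv.swap i k).toPEquiv.toMatrix
  inv := (Equiv.swap i k).toPEquiv.toMatrix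
  val_inv := by
    rw [PEquiv.toMatrix_toPEquiv_mul]
    ext a b
    simp [PEquiv.toMatrix_apply, one_apply]
  inv_val := by
    rw [PEquiv.toMatrix_toPEquiv_mul]
    ext a b
    simp [PEquiv.toMatrix_apply, one_apply]

theorem swapUnit_mul (i k : ι) (A : Matrix ι ι S) :
    (swapUnit S i k).val * A = A.submatrix (Equiv.swap i k) (Equiv.refl ι) :=
  PEquiv.toMatrix_toPEquiv_mul _ _

theorem mul_swapUnit (i k : ι) (A : Matrix ι ι S) :
    A * (swapUnit S i k).val = A.submatrix (Equiv.refl ι) (Equiv.swap i k) :=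
  PEquiv.mul_toMatrix_toPEquiv _ _

/-- Exchanging the rows of `[1, b; b, 1]` has the same effect as exchanging its columns. -/
theorem relH_swap (i j k l : ι) (b : S) :
    RelH (single i j (1 : S) + single k l 1 + b • (single i l 1 + single k j 1))
      (single i l 1 + single k j 1 + b • (single i j 1 + single k l 1)) := by
  refine relH_of_units (swapUnit S i k) (swapUnit S j l) ?_ ?_
  · rw [swapUnit_mul]
    simp only [submatrix_add, submatrix_smul, Pi.add_apply, Pi.smul_apply, submatrix_single_equiv]
    simp [add_comm]
  · rw [mul_swapUnit]
    simp only [submatrix_add, submatrix_smul, Pi.add_apply, Pi.smul_apply, submatrix_single_equiv]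
    simp [add_comm]

theorem exists_row_of_leR {A B : Matrix ι ι S} (h : LeR A B) {i j : ι} (hij : A i j ≠ 0) :
    ∃ s, B i s ≠ 0 := by
  obtain ⟨X, rfl⟩ := h
  by_contra! hc
  exact hij (by simp [Matrix.mul_apply, hc])

theorem exists_col_of_leL {A B : Matrix ι ι S} (h : LeL A B) {i j : ι} (hij : A i j ≠ 0) :
    ∃ s, B s j ≠ 0 := by
  obtain ⟨X, rfl⟩ := h
  by_contra! hc
  exact hij (by simp [Matrix.mul_apply, hc])

theorem preserves_relH_hadamard {T : Matrix ι ι S → Matrix ι ι S} {C : Matrix ι ι S}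
    (h : IsHadamardStandard T C) (hT : Preserves T RelH) : Preserves (C ⊙ ·) RelH := by
  have aux (P Q : (Matrix ι ι S)ˣ) {A B : Matrix ι ι S}
      (h : RelH (P.val * A * Q.val) (P.val * B * Q.val)) : RelH A B := by
    have := h.units_mul_mul P⁻¹ Q⁻¹
    simpa [Matrix.mul_assoc] using this
  obtain ⟨-, P, Q, h | h⟩ := h
  · intro A B hAB
    have := hT _ _ hAB
    rw [h, h] at this
    exact aux P Q this
  · intro A B hAB
    have := hT _ _ hAB.transpose
    rw [h, h] at this
    exact aux P Q this

section Zerosumfree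

variable (hS : Zerosumfree S)
include hS

theorem Zerosumfree.minor_of_preserves_relH {C : Matrix ι ι S} (h0 : ∀ i j, C i j ≠ 0)
    (hC : Preserves (C ⊙ ·) RelH) (i j k l : ι) : C i j * C k l = C i l * C k j := by
  by_cases hik : i = k
  · subst hik; ring
  by_cases hjl : j = l
  · subst hjl; ring
  have main (j l : ι) (hjl : j ≠ l) (b : S) (hb : b ≠ 0) : ∃ x z, x + z = 1 ∧
      b ^ 2 * x + C i j * C k l / (C i l * C k j) * z = 1 := by
    -- Column `j` of this factorization, in rows `i` and `k`, yields the two equations after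
    -- rescaling `X j j` and `X l j`. Exchanging `j` and `l` inverts the cross-ratio.
    obtain ⟨X, hX⟩ := (hC _ _ (relH_swap i j k l b)).1.2
    have hsum (f : ι → S) (hf : ∀ s, s ≠ j → s ≠ l → f s = 0) :
        ∑ s, f s = f j + f l := by
      rw [← Finset.sum_pair hjl]
      refine (Finset.sum_subset (Finset.subset_univ _) fun s _ hs => ?_).symm
      simp only [Finset.mem_insert, Finset.mem_singleton, not_or] at hs
      exact hf s hs.1 hs.2
    have hentry (r : ι) := (congrFun (congrFun hX r) j).trans
      ((Matrix.mul_apply).trans (hsum _ fun s hsj hsl => ?_))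
    · have hki : k ≠ i := Ne.symm hik
      have hlj : l ≠ j := Ne.symm hjl
      have h1 := hentry i
      have h2 := hentry k
      simp [hik, hjl, hki, hlj] at h1 h2
      refine ⟨X j j / b, X l j * C i l / C i j, ?_, ?_⟩
      · have := h0 i j
        field_simp
        exact Eq.trans (by ring) (h1.symm.trans (mul_comm _ _))
      · have h3 := h0 i j
        have h4 := h0 i l
        have h5 := h0 k j
        field_simp
        exact Eq.trans (by ring) h2.symm
    · simp [Ne.symm hsj, Ne.symm hsl]
  have hm : C i j * C k l / (C i l * C k j) = 1 := by
    refine hS.eq_one (div_ne_zero (mul_ne_zero (h0 _ _) (h0 _ _)) (mul_ne_zero (h0 _ _) (h0 _ _)))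
      (main j l hjl) ?_
    rw [inv_div]
    exact main l j (Ne.symm hjl)
  rwa [div_eq_one_iff_eq (mul_ne_zero (h0 _ _) (h0 _ _))] at hm

variable {T : Matrix ι ι S →ₗ[S] Matrix ι ι S}

omit hS in
theorem exists_isHadamardStandard_of_map_single [Nontrivial ι] (hT : Function.Bijective T)
    {p : ι → ι → ι × ι} {c : ι → ι → S} (hc : ∀ i j, c i j ≠ 0)
    (h : ∀ i j, T (single i j 1) = c i j • single (p i j).1 (p i j).2 1)
    (hcol : ∀ i j k l, i = k ∨ j = l → (p i j).1 = (p k l).1 ∨ (p i j).2 = (p k l).2) :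
    ∃ C, IsHadamardStandard T C := by
  have key (i j k l) (hijkl : i = k ∨ j = l) :
      Parallel (Pi.single (p i j).1 (c i j)) (Pi.single (p k l).1 (c k l)) ∨
        Parallel (Pi.single (p i j).2 (1 : S)) (Pi.single (p k l).2 1) := by
    refine (hcol i j k l hijkl).imp (fun h1 => ?_) (fun h1 => ?_)
    · refine ⟨c i j / c k l, div_ne_zero (hc _ _) (hc _ _), ?_⟩
      rw [h1, ← Pi.single_smul, smul_eq_mul, div_mul_cancel₀ _ (hc k l)]
    · exact ⟨1, one_ne_zero, by rw [h1, one_smul]⟩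
  refine exists_isHadamardStandard hT (u := fun i j => Pi.single (p i j).1 (c i j))
    (v := fun i j => Pi.single (p i j).2 1) (fun i j => ?_)
    (fun i j l => key i j i l (Or.inl rfl)) (fun i k j => key i j k j (Or.inr rfl))
  rw [h, ← single_eq_vecMulVec, smul_single, smul_eq_mul, mul_one]

theorem Zerosumfree.isStandard_of_preserves_relJ [Nontrivial ι] (hT : Function.Bijective T)
    (h : Preserves T RelJ) : IsStandard T := by
  choose p c hc hp using hS.exists_map_single hT
  obtain ⟨i₀⟩ := (inferInstance : Nonempty ι)
  have hout {B : Matrix ι ι S} (hB : IsOuter B) : IsOuter (T B) := by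
    refine isOuter_map_of_preserves_relJ h (isOuter_single i₀ i₀ 1)
      (single_ne_zero_of_ne_zero _ _ one_ne_zero) ?_ hB
    rw [hp, smul_single, smul_eq_mul, mul_one]
    exact isOuter_single _ _ _
  have hcol (i j k l) (hijkl : i = k ∨ j = l) :
      (p i j).1 = (p k l).1 ∨ (p i j).2 = (p k l).2 := by
    have h1 : IsOuter (single i j 1 + single k l 1 : Matrix ι ι S) := by
      rcases hijkl with rfl | rfl
      · rw [single_eq_vecMulVec, single_eq_vecMulVec, ← vecMulVec_add]
        exact isOuter_vecMulVec _ _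
      · rw [single_eq_vecMulVec, single_eq_vecMulVec, ← add_vecMulVec]
        exact isOuter_vecMulVec _ _
    have h2 := (hout h1).minor (p i j).1 (p i j).2 (p k l).1 (p k l).2
    rw [map_add, hp, hp] at h2
    by_contra! hne
    simp [hc, hne.1, hne.2, hne.1.symm, hne.2.symm] at h2
  obtain ⟨C, hC⟩ := exists_isHadamardStandard_of_map_single hT hc hp hcol
  exact hC.isStandard (hC.isOuter (hout (isOuter_vecMulVec _ _)))

theorem Zerosumfree.isStandard_of_preserves_relH [Nontrivial ι] (hT : Function.Bijective T)
    (h : Preserves T RelH) : IsStandard T := by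
  choose p c hc hp using hS.exists_map_single hT
  have hinj (i j k l) (hpp : p i j = p k l) : i = k ∧ j = l := by
    have h1 : T (c k l • single i j 1) = T (c i j • single k l 1) := by
      rw [map_smul, map_smul, hp, hp, hpp, smul_comm]
    have h2 := congrFun (congrFun (hT.1 h1) i) j
    by_contra hne
    have hne' : ¬ (k = i ∧ l = j) := fun h => hne ⟨h.1.symm, h.2.symm⟩
    simp [hne', hc] at h2
  -- The image of the unit at `(i, l)` shares a row with one of the images of the units at `(i, j)`
  -- and `(k, l)`, and a column with one of them. It equals neither, so it meets one in its row and
  -- the other in its column; collinearity of those two would force an equality.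
  have hnc (i j k l) (hik : i ≠ k) (hjl : j ≠ l) :
      (p i j).1 ≠ (p k l).1 ∧ (p i j).2 ≠ (p k l).2 := by
    have hH := h _ _ (relH_swap i j k l 0)
    simp only [zero_smul, add_zero, map_add, hp] at hH
    have hpos : (c i l • single (p i l).1 (p i l).2 1 +
        c k j • single (p k j).1 (p k j).2 1 : Matrix ι ι S) (p i l).1 (p i l).2 ≠ 0 := by
      intro h0
      rw [Matrix.add_apply] at h0
      have := hS _ _ h0
      simp [hc] at this
    obtain ⟨s, hs⟩ := exists_row_of_leR hH.1.2 hpos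
    obtain ⟨t, ht⟩ := exists_col_of_leL hH.2.2 hpos
    have hs' : (p i j).1 = (p i l).1 ∨ (p k l).1 = (p i l).1 := by
      by_contra! hne
      simp [hne.1, hne.2] at hs
    have ht' : (p i j).2 = (p i l).2 ∨ (p k l).2 = (p i l).2 := by
      by_contra! hne
      simp [hne.1, hne.2] at ht
    have h1 : p i j ≠ p i l := fun h => hjl (hinj _ _ _ _ h).2
    have h2 : p k l ≠ p i l := fun h => hik (hinj _ _ _ _ h).1.symm
    rw [Ne, Prod.ext_iff] at h1 h2
    constructor <;> intro h3 <;> grind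
  have hcol (i j k l) (hijkl : i = k ∨ j = l) :
      (p i j).1 = (p k l).1 ∨ (p i j).2 = (p k l).2 := by
    -- The map on non-collinear pairs is injective on a finite set, hence onto, so no collinear pair
    -- can have a non-collinear image.
    let N := {x : (ι × ι) × (ι × ι) // x.1.1 ≠ x.2.1 ∧ x.1.2 ≠ x.2.2}
    let f : N → N := fun x => ⟨(p x.1.1.1 x.1.1.2, p x.1.2.1 x.1.2.2), hnc _ _ _ _ x.2.1 x.2.2⟩
    have hf : Function.Injective f := by
      rintro ⟨⟨⟨a, b⟩, ⟨a', b'⟩⟩, hx⟩ ⟨⟨⟨d, e⟩, ⟨d', e'⟩⟩, hy⟩ hxy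
      replace hxy := Prod.ext_iff.1 (congrArg Subtype.val hxy)
      obtain ⟨rfl, rfl⟩ := hinj _ _ _ _ hxy.1
      obtain ⟨rfl, rfl⟩ := hinj _ _ _ _ hxy.2
      rfl
    by_contra! hne
    obtain ⟨⟨⟨⟨a, b⟩, ⟨a', b'⟩⟩, hx⟩, hfx⟩ :=
      Finite.surjective_of_injective hf ⟨(p i j, p k l), hne⟩
    replace hfx := Prod.ext_iff.1 (congrArg Subtype.val hfx)
    obtain ⟨rfl, rfl⟩ := hinj _ _ _ _ hfx.1
    obtain ⟨rfl, rfl⟩ := hinj _ _ _ _ hfx.2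
    exact hijkl.elim hx.1 hx.2
  obtain ⟨C, hC⟩ := exists_isHadamardStandard_of_map_single hT hc hp hcol
  exact hC.isStandard (isOuter_of_minor
    (hS.minor_of_preserves_relH hC.1 (preserves_relH_hadamard hC h)))

end Zerosumfree

end Green

/-! ### Preservers over a field. -/

namespace Green

open Matrix

section Semifield

variable {S ι : Type*} [Semifield S] [Fintype ι] [DecidableEq ι]

theorem IsStandard.of_rightInverse {T U : Matrix ι ι S → Matrix ι ι S} (h : IsStandard T)
    (hTU : ∀ A, T (U A) = A) : IsStandard U := by
  obtain ⟨P, Q, h⟩ := h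
  have aux {X B : Matrix ι ι S} (hX : P.val * X * Q.val = B) :
      X = (P⁻¹ : (Matrix ι ι S)ˣ).val * B * (Q⁻¹ : (Matrix ι ι S)ˣ).val := by
    simp [← hX, Matrix.mul_assoc]
  rcases h with h | h
  · exact ⟨P⁻¹, Q⁻¹, Or.inl fun A => aux (by rw [← h, hTU])⟩
  · have hunit (W : (Matrix ι ι S)ˣ) : ∃ V : (Matrix ι ι S)ˣ, V.val = W.valᵀ :=
      ⟨⟨W.valᵀ, (W⁻¹ : (Matrix ι ι S)ˣ).valᵀ, by rw [← transpose_mul]; simp,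
        by rw [← transpose_mul]; simp⟩, rfl⟩
    obtain ⟨P', hP'⟩ := hunit P⁻¹
    obtain ⟨Q', hQ'⟩ := hunit Q⁻¹
    -- Undoing the transpose exchanges the left and right factors.
    refine ⟨Q', P', Or.inr fun A => ?_⟩
    rw [hP', hQ', ← transpose_transpose (U A),
      aux (X := (U A)ᵀ) (by rw [← h, hTU]), transpose_mul, transpose_mul, Matrix.mul_assoc]

theorem IsOuter.add_of_left_parallel {u v u' v' : ι → S} (h : Parallel u u') (c : S) :
    IsOuter (vecMulVec u v + c • vecMulVec u' v') := by
  obtain ⟨d, hd, rfl⟩ := h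
  refine ⟨u', d • v + c • v', ?_⟩
  rw [vecMulVec_add, vecMulVec_smul, vecMulVec_smul, smul_vecMulVec]

theorem IsOuter.add_of_right_parallel {u v u' v' : ι → S} (h : Parallel v v') (c : S) :
    IsOuter (vecMulVec u v + c • vecMulVec u' v') := by
  obtain ⟨d, hd, rfl⟩ := h
  refine ⟨d • u + c • u', v', ?_⟩
  rw [add_vecMulVec, smul_vecMulVec, smul_vecMulVec, vecMulVec_smul]

end Semifield

variable {K ι : Type*} [Field K] [Fintype ι] [DecidableEq ι]

/-- The 2×2 minors of the sum factor as a minor of `u, u'` times a minor of `v, v'`. -/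
theorem parallel_or_parallel {u v u' v' : ι → K} (hu : u ≠ 0) (hv : v ≠ 0) (hu' : u' ≠ 0)
    (hv' : v' ≠ 0) (h : IsOuter (vecMulVec u v + vecMulVec u' v')) :
    Parallel u u' ∨ Parallel v v' := by
  by_contra! hc
  obtain ⟨i, k, hik⟩ : ∃ i k, u i * u' k ≠ u k * u' i := by
    by_contra! h1
    exact hc.1 (parallel_of_minor hu hu' h1)
  obtain ⟨j, l, hjl⟩ : ∃ j l, v j * v' l ≠ v l * v' j := by
    by_contra! h1
    exact hc.2 (parallel_of_minor hv hv' h1)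
  have h1 := h.minor i j k l
  simp only [Matrix.add_apply, vecMulVec_apply] at h1
  have h2 : (u i * u' k - u k * u' i) * (v j * v' l - v l * v' j) = 0 := by
    linear_combination h1
  exact (mul_ne_zero (sub_ne_zero.2 hik) (sub_ne_zero.2 hjl)) h2

theorem isStandard_of_isOuter_map [Nontrivial ι] {T : Matrix ι ι K →ₗ[K] Matrix ι ι K}
    (hT : Function.Bijective T) (h : ∀ A, IsOuter A → IsOuter (T A)) : IsStandard T := by
  choose u v huv using fun i j => h _ (isOuter_single i j 1)
  have hne (i j) : u i j ≠ 0 ∧ v i j ≠ 0 := by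
    refine exists_ne_zero_of_vecMulVec_ne_zero ?_
    rw [← huv, Ne, map_eq_zero_iff T hT.1]
    exact single_ne_zero_of_ne_zero _ _ one_ne_zero
  have key (i j k l) (hij : IsOuter (single i j 1 + single k l 1 : Matrix ι ι K)) :
      Parallel (u i j) (u k l) ∨ Parallel (v i j) (v k l) := by
    refine parallel_or_parallel (hne _ _).1 (hne _ _).2 (hne _ _).1 (hne _ _).2 ?_
    rw [← huv, ← huv, ← map_add]
    exact h _ hij
  obtain ⟨C, hC⟩ := exists_isHadamardStandard hT huv
    (fun i j l => key _ _ _ _ (by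
      rw [single_eq_vecMulVec, single_eq_vecMulVec, ← vecMulVec_add]
      exact isOuter_vecMulVec _ _))
    (fun i k j => key _ _ _ _ (by
      rw [single_eq_vecMulVec, single_eq_vecMulVec, ← add_vecMulVec]
      exact isOuter_vecMulVec _ _))
  exact hC.isStandard (hC.isOuter (h _ (isOuter_vecMulVec _ _)))

theorem exists_eq_units_mul_diagonal_mul (A : Matrix ι ι K) :
    ∃ (P Q : (Matrix ι ι K)ˣ) (D : ι → K), A = P.val * diagonal D * Q.val := by
  obtain ⟨L, L', D, h⟩ := Pivot.exists_list_transvec_mul_diagonal_mul_list_transvec A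
  have hunit (L : List (TransvectionStruct ι K)) :
      IsUnit (L.map TransvectionStruct.toMatrix).prod := by
    rw [isUnit_iff_isUnit_det, TransvectionStruct.det_toMatrix_prod]
    exact isUnit_one
  obtain ⟨P, hP⟩ := hunit L
  obtain ⟨Q, hQ⟩ := hunit L'
  exact ⟨P, Q, D, by rw [hP, hQ, h]⟩

theorem isOuter_diagonal {D : ι → K} (h : ∀ i j, i ≠ j → D i = 0 ∨ D j = 0) :
    IsOuter (diagonal D) := by
  refine isOuter_of_minor fun i j k l => ?_
  simp only [diagonal_apply]
  grind

theorem exists_diagonal_of_not_isOuter {A : Matrix ι ι K} (hA : ¬ IsOuter A) :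
    ∃ (P Q : (Matrix ι ι K)ˣ) (D : ι → K), A = P.val * diagonal D * Q.val ∧
      ∃ i j, i ≠ j ∧ D i ≠ 0 ∧ D j ≠ 0 := by
  obtain ⟨P, Q, D, rfl⟩ := exists_eq_units_mul_diagonal_mul A
  refine ⟨P, Q, D, rfl, ?_⟩
  by_contra! hD
  refine hA ((relJ_units_mul_mul P Q _).1.isOuter (isOuter_diagonal fun i j hij => ?_))
  exact or_iff_not_imp_left.2 (hD i j hij)

/-- Transvections are units. -/
theorem exists_units_eq_transvection {i j : ι} (hij : i ≠ j) (c : K) :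
    ∃ U : (Matrix ι ι K)ˣ, U.val = 1 + single i j c := by
  have : IsUnit (transvection i j c) := by
    rw [isUnit_iff_isUnit_det, det_transvection_of_ne i j hij]
    exact isUnit_one
  exact this

theorem single_mul_diagonal (i j : ι) (c : K) (D : ι → K) :
    single i j c * diagonal D = single i j (c * D j) := by
  ext a b
  rw [mul_diagonal]
  by_cases h : i = a ∧ j = b
  · obtain ⟨rfl, rfl⟩ := h
    simp
  · simp [h]

theorem diagonal_mul_single (i j : ι) (c : K) (D : ι → K) :
    diagonal D * single i j c = single i j (D i * c) := by
  ext a b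
  rw [diagonal_mul]
  by_cases h : i = a ∧ j = b
  · obtain ⟨rfl, rfl⟩ := h
    simp
  · simp [h]

/-- Row `j` of the diagonal matrix has a single nonzero entry, so adding multiples of it to rows `i`
and `k` changes only column `j`. The case `i = k` is allowed. -/
theorem relJ_diagonal_add_single_add_single {D : ι → K} {i j k : ι} (hij : i ≠ j) (hkj : k ≠ j)
    (hj : D j ≠ 0) (c c' : K) :
    RelJ (diagonal D + single i j c + single k j c') (diagonal D) := by
  obtain ⟨U, hU⟩ := exists_units_eq_transvection hij (c / D j)
  obtain ⟨V, hV⟩ := exists_units_eq_transvection hkj (c' / D j)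
  have h1 : diagonal D + single k j c' + single i j c =
      (V * U).val * diagonal D * (1 : (Matrix ι ι K)ˣ).val := by
    rw [Units.val_mul, hU, hV, Units.val_one, Matrix.mul_one]
    simp only [Matrix.add_mul, Matrix.mul_add, Matrix.one_mul, Matrix.mul_one]
    rw [single_mul_single_of_ne _ _ _ _ hij.symm, Matrix.zero_mul, add_zero,
      single_mul_diagonal, single_mul_diagonal, div_mul_cancel₀ _ hj, div_mul_cancel₀ _ hj]
  rw [add_right_comm, h1]
  exact relJ_units_mul_mul _ _ _

theorem relJ_diagonal_add_single {D : ι → K} {i j : ι} (hij : i ≠ j) (hj : D j ≠ 0) (c : K) :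
    RelJ (diagonal D + single i j c) (diagonal D) := by
  simpa using relJ_diagonal_add_single_add_single hij hij hj c 0

theorem relH_diagonal_add_single {D : ι → K} {i j : ι} (hij : i ≠ j) (hi : D i ≠ 0)
    (hj : D j ≠ 0) : RelH (diagonal D) (diagonal D + single i j 1) := by
  obtain ⟨U, hU⟩ := exists_units_eq_transvection hij (1 / D j)
  obtain ⟨V, hV⟩ := exists_units_eq_transvection hij (1 / D i)
  refine relH_of_units U V ?_ ?_
  · rw [hU, Matrix.add_mul, Matrix.one_mul, single_mul_diagonal, div_mul_cancel₀ _ hj]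
  · rw [hV, Matrix.mul_add, Matrix.mul_one, diagonal_mul_single, mul_div_cancel₀ _ hi]

/-- A matrix that is not an outer product is H-related to one that is not a scalar multiple of it,
whereas only scalar multiples lie H-below an outer product. -/
theorem isOuter_of_isOuter_map_of_preserves_relH {T : Matrix ι ι K →ₗ[K] Matrix ι ι K}
    (hT : Function.Injective T) (h : Preserves T RelH) {A : Matrix ι ι K}
    (hA : IsOuter (T A)) : IsOuter A := by
  by_contra hA'
  obtain ⟨P, Q, D, rfl, i, j, hij, hi, hj⟩ := exists_diagonal_of_not_isOuter hA'
  have h1 := h _ _ ((relH_diagonal_add_single hij hi hj).units_mul_mul P Q)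
  obtain ⟨u, v, huv⟩ := hA
  rw [huv] at h1
  obtain ⟨c, hc⟩ := eq_smul_of_leH_vecMulVec (relH_iff_leH.1 h1).2
  rw [← huv, ← map_smul] at hc
  have h2 := congrArg (fun X => (P⁻¹ : (Matrix ι ι K)ˣ).val * X * (Q⁻¹ : (Matrix ι ι K)ˣ).val)
    (hT hc)
  have h3 : diagonal D + single i j 1 = c • diagonal D := by
    simpa [Matrix.mul_assoc] using h2
  have h4 := congrFun (congrFun h3 i) j
  simp [hij] at h4

theorem isStandard_of_preserves_relH [Nontrivial ι] {T : Matrix ι ι K →ₗ[K] Matrix ι ι K}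
    (hT : Function.Bijective T) (h : Preserves T RelH) : IsStandard T := by
  let e := LinearEquiv.ofBijective T hT
  have he : IsStandard e.symm.toLinearMap := by
    refine isStandard_of_isOuter_map e.symm.bijective fun A hA => ?_
    refine isOuter_of_isOuter_map_of_preserves_relH hT.1 h ?_
    exact (e.apply_symm_apply A).symm ▸ hA
  exact he.of_rightInverse e.symm_apply_apply

theorem eq_add_of_vecMulVec_add_eq (hK : ∀ c : K, c = 0 ∨ c = 1) {u₀ u₁ u₂ u₃ v₀ v₁ v₂ v₃ : ι → K}
    (h : vecMulVec u₀ v₀ + vecMulVec u₃ v₃ = vecMulVec u₁ v₁ + vecMulVec u₂ v₂) (hu : u₀ ≠ 0)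
    (hv₀ : v₀ ≠ 0) (hv₃ : v₃ ≠ 0) (h03 : ¬ Parallel v₀ v₃) (h01 : u₀ ≠ u₁) (h02 : u₀ ≠ u₂) :
    u₀ = u₁ + u₂ := by
  obtain ⟨a, b, hab⟩ : ∃ a b, v₀ a * v₃ b ≠ v₀ b * v₃ a := by
    by_contra! h1
    exact h03 (parallel_of_minor hv₀ hv₃ h1)
  have hd : v₀ a * v₃ b - v₀ b * v₃ a = 1 := (hK _).resolve_left (sub_ne_zero.2 hab)
  -- Contracting with the vector having entries `v₃ b` at `a` and `-v₃ a` at `b` kills `v₃` and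
  -- pairs with `v₀` to 1.
  have key : u₀ = (v₁ a * v₃ b - v₁ b * v₃ a) • u₁ + (v₂ a * v₃ b - v₂ b * v₃ a) • u₂ := by
    ext k
    have ha := congrFun (congrFun h k) a
    have hb := congrFun (congrFun h k) b
    simp only [Matrix.add_apply, vecMulVec_apply] at ha hb
    simp only [Pi.add_apply, Pi.smul_apply, smul_eq_mul]
    linear_combination v₃ b * ha - v₃ a * hb - u₀ k * hd
  rcases hK (v₁ a * v₃ b - v₁ b * v₃ a) with h1 | h1 <;>
    rcases hK (v₂ a * v₃ b - v₂ b * v₃ a) with h2 | h2 <;> simp only [h1, h2] at key <;> simp_all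

/-! ### Finding one nonzero outer product with outer image. -/

section Core

variable {T : Matrix ι ι K →ₗ[K] Matrix ι ι K}

/-- If there were none, `x + c α + c' β` would always be outer and a nontrivial `c α + c' β` never.
This forces the two-element field, where `x + (x + α + β) = (x + α) + (x + β)` makes the left
factors of `x` and `x + α + β` both equal `u₁ + u₂`, so their difference is outer. -/
theorem exists_isOuter_map_of_third_index (hT : Preserves T RelJ) {D : ι → K} {i j k : ι}
    (hij : i ≠ j) (hkj : k ≠ j) (hik : i ≠ k) (hj : D j ≠ 0) (hD : IsOuter (T (diagonal D))) :
    ∃ X, X ≠ 0 ∧ IsOuter X ∧ IsOuter (T X) := by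
  by_contra! hc
  have hJ (c c' : K) : IsOuter (T (diagonal D) + c • T (single i j 1) + c' • T (single k j 1)) := by
    have h1 := hT _ _ (relJ_diagonal_add_single_add_single hij hkj hj c c')
    have h2 := h1.1.isOuter hD
    have e (i : ι) (c : K) : T (single i j c) = c • T (single i j 1) := by
      rw [← map_smul, smul_single, smul_eq_mul, mul_one]
    rwa [map_add, map_add, e i c, e k c'] at h2
  have hnot (c c' : K) (hcc : c ≠ 0 ∨ c' ≠ 0) :
      ¬ IsOuter (c • T (single i j 1) + c' • T (single k j 1)) := by
    rw [← map_smul, ← map_smul, ← map_add]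
    apply hc
    · intro h0
      have h1 := congrFun (congrFun h0 i) j
      have h2 := congrFun (congrFun h0 k) j
      simp [hik, hik.symm] at h1 h2
      tauto
    · simp only [smul_single, smul_eq_mul, mul_one]
      rw [single_eq_vecMulVec, single_eq_vecMulVec, ← add_vecMulVec]
      exact isOuter_vecMulVec _ _
  obtain ⟨u₀, v₀, h₀⟩ := hJ 0 0
  obtain ⟨u₁, v₁, h₁⟩ := hJ 1 0
  obtain ⟨u₂, v₂, h₂⟩ := hJ 0 1
  obtain ⟨u₃, v₃, h₃⟩ := hJ 1 1
  simp only [one_smul, zero_smul, add_zero] at h₀ h₁ h₂ h₃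
  set x := T (diagonal D)
  set α := T (single i j 1)
  set β := T (single k j 1)
  have hpar {u v u' v' : ι → K} (c c' : K) (hcc : c ≠ 0 ∨ c' ≠ 0)
      (h : vecMulVec u v + (-1 : K) • vecMulVec u' v' = c • α + c' • β) :
      ¬ Parallel u u' ∧ ¬ Parallel v v' := by
    constructor <;> intro hp <;> refine hnot c c' hcc (h ▸ ?_)
    · exact IsOuter.add_of_left_parallel hp _
    · exact IsOuter.add_of_right_parallel hp _
  have h01 := hpar (u := u₀) (v := v₀) (u' := u₁) (v' := v₁) (-1) 0 (by simp)
    (by rw [← h₀, ← h₁]; module)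
  have h02 := hpar (u := u₀) (v := v₀) (u' := u₂) (v' := v₂) 0 (-1) (by simp)
    (by rw [← h₀, ← h₂]; module)
  have h03 := hpar (u := u₀) (v := v₀) (u' := u₃) (v' := v₃) (-1) (-1) (by simp)
    (by rw [← h₀, ← h₃]; module)
  have h30 := hpar (u := u₃) (v := v₃) (u' := u₀) (v' := v₀) 1 1 (by simp)
    (by rw [← h₀, ← h₃]; module)
  have h31 := hpar (u := u₃) (v := v₃) (u' := u₁) (v' := v₁) 0 1 (by simp)
    (by rw [← h₃, ← h₁]; module)
  have h32 := hpar (u := u₃) (v := v₃) (u' := u₂) (v' := v₂) 1 0 (by simp)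
    (by rw [← h₃, ← h₂]; module)
  have parallel_refl (u : ι → K) : Parallel u u := ⟨1, one_ne_zero, by simp⟩
  have hne {u v u' v' : ι → K} (c c' : K) (hcc : c ≠ 0 ∨ c' ≠ 0)
      (h : vecMulVec u v + (-1 : K) • vecMulVec u' v' = c • α + c' • β) : u ≠ 0 ∧ v ≠ 0 := by
    refine exists_ne_zero_of_vecMulVec_ne_zero fun h0 => hnot c c' hcc ?_
    rw [← h, h0, zero_add, ← smul_vecMulVec]
    exact isOuter_vecMulVec _ _
  have hne₀ := hne (u := u₀) (v := v₀) (u' := u₁) (v' := v₁) (-1) 0 (by simp)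
    (by rw [← h₀, ← h₁]; module)
  have hne₁ := hne (u := u₁) (v := v₁) (u' := u₀) (v' := v₀) 1 0 (by simp)
    (by rw [← h₀, ← h₁]; module)
  have hne₃ := hne (u := u₃) (v := v₃) (u' := u₀) (v' := v₀) 1 1 (by simp)
    (by rw [← h₀, ← h₃]; module)
  -- For any other `c`, `x + c α = (1 - c) x + c (x + α)` is an outer sum of outer products, so `x`
  -- and `x + α` have a parallel factor, which is excluded.
  have hK (c : K) : c = 0 ∨ c = 1 := by
    by_contra! hcc
    have h1 : 1 - c ≠ 0 := sub_ne_zero.2 hcc.2.symm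
    have h2 : IsOuter (vecMulVec ((1 - c) • u₀) v₀ + vecMulVec (c • u₁) v₁) := by
      rw [smul_vecMulVec, smul_vecMulVec, ← h₀, ← h₁]
      convert hJ c 0 using 1
      module
    rcases parallel_or_parallel (smul_ne_zero h1 hne₀.1) hne₀.2 (smul_ne_zero hcc.1 hne₁.1)
      hne₁.2 h2 with ⟨d, hd, hp⟩ | hp
    · refine h01.1 ⟨(1 - c)⁻¹ * (d * c), mul_ne_zero (inv_ne_zero h1) (mul_ne_zero hd hcc.1), ?_⟩
      rw [mul_smul, mul_smul, ← hp, smul_smul, inv_mul_cancel₀ h1, one_smul]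
    · exact h01.2 hp
  have hsum : vecMulVec u₀ v₀ + vecMulVec u₃ v₃ = vecMulVec u₁ v₁ + vecMulVec u₂ v₂ := by
    rw [← h₀, ← h₁, ← h₂, ← h₃]
    module
  have e0 := eq_add_of_vecMulVec_add_eq hK hsum hne₀.1 hne₀.2 hne₃.2 h03.2
    (fun h => h01.1 (h ▸ parallel_refl _)) (fun h => h02.1 (h ▸ parallel_refl _))
  have e3 := eq_add_of_vecMulVec_add_eq hK ((add_comm _ _).trans hsum) hne₃.1 hne₃.2 hne₀.2 h30.2
    (fun h => h31.1 (h ▸ parallel_refl _)) (fun h => h32.1 (h ▸ parallel_refl _))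
  exact h03.1 (by rw [e0, e3]; exact parallel_refl _)

/-- For size 2, outer means determinant 0. The quadratic `d (x + c α)` vanishes for all `c` with
leading coefficient `d α ≠ 0`, so the field has two elements. Polarization then gives `d (x + α + β)
= 0`, although `x + α + β` is the image of the nonzero outer product `D 1ᵀ`. -/
theorem exists_isOuter_map_of_two_indices (hT : Preserves T RelJ) {D : ι → K} {i j : ι}
    (hij : i ≠ j) (hall : ∀ k, k = i ∨ k = j) (hi : D i ≠ 0) (hj : D j ≠ 0)
    (hD : IsOuter (T (diagonal D))) : ∃ X, X ≠ 0 ∧ IsOuter X ∧ IsOuter (T X) := by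
  by_contra! hc
  let d : Matrix ι ι K → K := fun M => M i i * M j j - M i j * M j i
  have hd (M : Matrix ι ι K) : IsOuter M ↔ d M = 0 := by
    refine ⟨fun h => sub_eq_zero.2 (h.minor i i j j), fun h => isOuter_of_minor fun a b a' b' => ?_⟩
    have h' : M i i * M j j = M i j * M j i := sub_eq_zero.1 h
    rcases hall a with rfl | rfl <;> rcases hall b with rfl | rfl <;>
      rcases hall a' with rfl | rfl <;> rcases hall b' with rfl | rfl <;> grind
  have e (i j : ι) (c c' : K) : T (single i j (c * c')) = c • T (single i j c') := by
    rw [← map_smul, smul_single, smul_eq_mul]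
  have h1 (c : K) : d (T (diagonal D) + c • T (single i j (D i))) = 0 := by
    rw [← hd, ← e, ← map_add]
    exact (hT _ _ (relJ_diagonal_add_single hij hj _)).1.isOuter hD
  have h2 (c : K) : d (T (diagonal D) + c • T (single j i (D j))) = 0 := by
    rw [← hd, ← e, ← map_add]
    exact (hT _ _ (relJ_diagonal_add_single hij.symm hi _)).1.isOuter hD
  have h3 : d (T (single i j (D i)) + T (single j i (D j))) = 0 := by
    rw [← hd, ← map_add]
    refine (hT _ (diagonal D) ?_).1.isOuter hD
    have : single i j (D i) + single j i (D j) =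
        (1 : (Matrix ι ι K)ˣ).val * diagonal D * (swapUnit K i j).val := by
      rw [Units.val_one, Matrix.one_mul, mul_swapUnit]
      ext a b
      rcases hall a with rfl | rfl <;> rcases hall b with rfl | rfl <;>
        simp [hij, hij.symm]
    rw [this]
    exact relJ_units_mul_mul _ _ _
  have h4 : d (T (single i j (D i))) ≠ 0 := by
    rw [Ne, ← hd]
    exact hc _ (single_ne_zero_of_ne_zero _ _ hi) (isOuter_single _ _ _)
  have h5 : d (T (single j i (D j))) ≠ 0 := by
    rw [Ne, ← hd]
    exact hc _ (single_ne_zero_of_ne_zero _ _ hj) (isOuter_single _ _ _)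
  have h6 : d (T (diagonal D) + T (single i j (D i)) + T (single j i (D j))) ≠ 0 := by
    rw [Ne, ← hd, ← map_add, ← map_add]
    have h7 : diagonal D + single i j (D i) + single j i (D j) = vecMulVec D 1 := by
      ext a b
      rcases hall a with rfl | rfl <;> rcases hall b with rfl | rfl <;>
        simp [hij, hij.symm]
    rw [h7]
    refine hc _ (fun h0 => ?_) (isOuter_vecMulVec _ _)
    have := congrFun (congrFun h0 i) i
    simp [hi] at this
  generalize T (diagonal D) = x at *
  generalize T (single i j (D i)) = α at *
  generalize T (single j i (D j)) = β at *
  simp only [d, Matrix.add_apply, Matrix.smul_apply, smul_eq_mul] at h1 h2 h3 h4 h5 h6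
  have hquad {y : Matrix ι ι K} (hy : y i i * y j j - y i j * y j i ≠ 0)
      (h : ∀ c, (x i i + c * y i i) * (x j j + c * y j j) -
        (x i j + c * y i j) * (x j i + c * y j i) = 0) (c : K) : c = 0 ∨ c = 1 := by
    have h7 : c * (c - 1) * (y i i * y j j - y i j * y j i) = 0 := by
      linear_combination h c - c * h 1 - (1 - c) * h 0
    have h8 := (mul_eq_zero.1 h7).resolve_right hy
    exact (mul_eq_zero.1 h8).imp_right sub_eq_zero.1
  have hα := (hquad h4 h1 _).resolve_left h4
  have hβ := (hquad h4 h1 _).resolve_left h5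
  have htwo : (1 : K) + 1 = 0 := (hquad h4 h1 (1 + 1)).resolve_right (by simp)
  apply h6
  linear_combination h1 1 + h2 1 - h1 0 + h3 - hα - hβ - htwo

end Core

theorem isStandard_of_preserves_relJ [Nontrivial ι] {T : Matrix ι ι K →ₗ[K] Matrix ι ι K}
    (hT : Function.Bijective T) (h : Preserves T RelJ) : IsStandard T := by
  obtain ⟨i₀⟩ := (inferInstance : Nonempty ι)
  obtain ⟨A, hA⟩ := hT.2 (single i₀ i₀ 1)
  obtain ⟨X, hX0, hX, hTX⟩ : ∃ X, X ≠ 0 ∧ IsOuter X ∧ IsOuter (T X) := by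
    have hTA : IsOuter (T A) := hA ▸ isOuter_single _ _ _
    by_cases hAo : IsOuter A
    · refine ⟨A, ?_, hAo, hTA⟩
      rintro rfl
      rw [map_zero] at hA
      exact single_ne_zero_of_ne_zero i₀ i₀ one_ne_zero hA.symm
    · obtain ⟨P, Q, D, rfl, i, j, hij, hi, hj⟩ := exists_diagonal_of_not_isOuter hAo
      let T' : Matrix ι ι K →ₗ[K] Matrix ι ι K :=
        { toFun := fun X => T (P.val * X * Q.val)
          map_add' := fun X Y => by rw [Matrix.mul_add, Matrix.add_mul, map_add]
          map_smul' := fun c X => by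
            rw [Matrix.mul_smul, Matrix.smul_mul, map_smul, RingHom.id_apply] }
      have hT' : Preserves T' RelJ := fun X Y hXY => h _ _ (hXY.units_mul_mul P Q)
      obtain ⟨X, hX0, hX, hTX⟩ : ∃ X, X ≠ 0 ∧ IsOuter X ∧ IsOuter (T' X) := by
        by_cases hk : ∃ k, k ≠ i ∧ k ≠ j
        · obtain ⟨k, hki, hkj⟩ := hk
          exact exists_isOuter_map_of_third_index hT' hij hkj hki.symm hj hTA
        · push Not at hk
          exact exists_isOuter_map_of_two_indices hT' hij
            (fun k => or_iff_not_imp_left.2 (hk k)) hi hj hTA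
      refine ⟨P.val * X * Q.val, fun h0 => hX0 ?_, (relJ_units_mul_mul P Q X).1.isOuter hX, hTX⟩
      have := congrArg
        (fun X => (P⁻¹ : (Matrix ι ι K)ˣ).val * X * (Q⁻¹ : (Matrix ι ι K)ˣ).val) h0
      simpa [Matrix.mul_assoc] using this
  exact isStandard_of_isOuter_map hT fun B hB => isOuter_map_of_preserves_relJ h hX hX0 hTX hB

end Green

/-! ### Sizes at most 1 and the field dichotomy. -/

namespace Green

open Matrix

variable {S ι : Type*} [Semifield S] [Fintype ι] [DecidableEq ι]
  {T : Matrix ι ι S →ₗ[S] Matrix ι ι S}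

theorem isStandard_of_subsingleton [Subsingleton ι] (hT : Function.Bijective T) :
    IsStandard T := by
  -- In size at most 1 every matrix is a scalar multiple of the identity.
  have key (A) : T A = A * T 1 := by
    cases isEmpty_or_nonempty ι
    · exact Subsingleton.elim _ _
    obtain ⟨i⟩ := ‹Nonempty ι›
    have h : A = A i i • 1 := by
      ext a b
      rw [Subsingleton.elim a i, Subsingleton.elim b i]
      simp
    conv_lhs => rw [h, map_smul]
    conv_rhs => rw [h, Matrix.smul_mul, Matrix.one_mul]
  obtain ⟨B, hB⟩ := hT.2 1
  rw [key] at hB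
  exact ⟨1, ⟨T 1, B, mul_eq_one_comm.1 hB, hB⟩, Or.inl fun A => by rw [key]; simp⟩

/-- A semifield in which `1` has an additive inverse is a field. -/
abbrev fieldOfOneAddEqZero (a : S) (ha : 1 + a = 0) : Field S :=
  { ‹Semifield S› with
    neg := fun x => a * x
    zsmul := @zsmulRec S ⟨0⟩ ⟨(· + ·)⟩ ⟨fun x => a * x⟩ nsmulRec
    neg_add_cancel := fun x => by
      change a * x + x = 0
      rw [← add_one_mul, add_comm, ha, zero_mul]
    qsmul := _
    qsmul_def := fun _ _ => rfl }

theorem isStandard_of_preserves [Nontrivial ι] (hT : Function.Bijective T)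
    (h : Preserves T RelJ ∨ Preserves T RelH) : IsStandard T := by
  by_cases ha : ∃ a : S, 1 + a = 0
  · obtain ⟨a, ha⟩ := ha
    -- The field structure extends the given semifield structure, so `T` and the relations are
    -- unchanged.
    exact h.elim (@isStandard_of_preserves_relJ S ι (fieldOfOneAddEqZero a ha) _ _ _ T hT)
      (@isStandard_of_preserves_relH S ι (fieldOfOneAddEqZero a ha) _ _ _ T hT)
  · push Not at ha
    have hS := zerosumfree_of_one_add_ne_zero ha
    exact h.elim (hS.isStandard_of_preserves_relJ hT) (hS.isStandard_of_preserves_relH hT)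

end Green

theorem mainTheorem5 {S : Type*} [Semifield S] (n : ℕ)
    (T : Matrix (Fin n) (Fin n) S →ₗ[S] Matrix (Fin n) (Fin n) S)
    (hT : Function.Bijective T) :
    List.TFAE [
      Green.Preserves T Green.RelJ,
      Green.Preserves T Green.LeJ,
      Green.Preserves T Green.RelH,
      Green.Preserves T Green.LeH,
      ∃ P Q : (Matrix (Fin n) (Fin n) S)ˣ,
        (∀ A : Matrix (Fin n) (Fin n) S, T A = P.val * A * Q.val) ∨
        (∀ A : Matrix (Fin n) (Fin n) S, T A = P.val * A.transpose * Q.val)] := by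
  have key (h : Green.Preserves T Green.RelJ ∨ Green.Preserves T Green.RelH) :
      Green.IsStandard T := by
    cases subsingleton_or_nontrivial (Fin n)
    · exact Green.isStandard_of_subsingleton hT
    · exact Green.isStandard_of_preserves hT h
  tfae_have 2 → 1 := Green.preserves_relJ_of_leJ
  tfae_have 4 → 3 := Green.preserves_relH_of_leH
  tfae_have 1 → 5 := fun h => key (Or.inl h)
  tfae_have 3 → 5 := fun h => key (Or.inr h)
  tfae_have 5 → 2 := Green.IsStandard.preserves_leJ
  tfae_have 5 → 4 := Green.IsStandard.preserves_leH
  tfae_finish
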